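/- Let $X$ be a Banach lattice with order-continuous norm (that is, $\inf_{x\in A}\|x\|=0$ for every non-empty downwards directed set $A\subset X$ with $\inf A=0$), and let $cwk(X)$ be the family of all non-empty, convex, weakly compact subsets of $X$. Let $[0,1]$ carry Lebesgue measure $\lambda$, and let $F:[0,1]\to cwk(X)$ be such that every $F(t)$ is order-bounded and $F(s)\subset F(t)$ whenever $0\le s\le t\le 1$. Then $F$ is (oH)-integrable, in the following sense. For every Borel set $E\subset[0,1]$ there exist a set $J_E\in cwk(X)$, a decreasing sequence $(b_n)_n$ in $X$ with $\bigwedge_n b_n=0$, and functions $\gamma_n:[0,1]\to(0,\infty)$ such that, for every $n$ and every $\gamma_n$-fine partition $\Pi=\{(E_i,t_i):i=1,\dots,k\}$ of $E$, $$\sum_{i=1}^k\lambda(E_i)F(t_i)\subset\mathcal U(J_E,b_n)\quad\text{and}\quad J_E\subset\mathcal U\Big(\sum_{i=1}^k\lambda(E_i)F(t_i),\,b_n\Big),$$ where sums and multiples of sets are taken in the sense of Minkowski and $\mathcal U(C,b)=\{z\in X:\ |z-y|\le b\text{ for some }y\in C\}$. Here a partition of $E$ is a finite family of pairs $(E_i,t_i)$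 with $E_i$ Borel, $\bigcup_iE_i=E$, $\lambda(E_i\cap E_j)=0$ for $i\ne j$, and $t_i\in[0,1]$ (not necessarily $t_i\in E_i$); it is $\gamma$-fine if $|w-t_i|<\gamma(t_i)$ for all $i$ and all $w\in E_i$. -/

import Mathlib

open MeasureTheory Set
open scoped Pointwise

namespace OrderHenstock

section BanachLattice

variable {X : Type*} [NormedAddCommGroup X]

/-- The norm of `X` is order-continuous: on every non-empty downwards directed set whose infimum
is `0` the norm has infimum `0`. -/
def OrderContinuousNorm (X : Type*) [NormedAddCommGroup X] [Lattice X] : Prop :=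
  ∀ A : Set X, A.Nonempty → DirectedOn (fun x y => y ≤ x) A → IsGLB A 0 →
    IsGLB (norm '' A) (0 : ℝ)

/-- The members of `cwk(X)`: the non-empty convex weakly compact subsets of `X`. -/
def IsCwk [NormedSpace ℝ X] (A : Set X) : Prop :=
  A.Nonempty ∧ Convex ℝ A ∧ IsCompact (toWeakSpace ℝ X '' A)

/-- `A` is order-bounded: it is contained in an order interval. -/
def IsOrderBounded [Lattice X] (A : Set X) : Prop :=
  ∃ a b : X, A ⊆ Icc a b

/-- An `(o)`-sequence: a decreasing sequence with infimum `0`. -/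
def IsOSeq [Lattice X] (b : ℕ → X) : Prop :=
  Antitone b ∧ IsGLB (range b) 0

/-- `𝒰(C, b)`, the set of all `z` with `|z - y| ≤ b` for some `y ∈ C`. -/
def orderNhd [Lattice X] (C : Set X) (b : X) : Set X :=
  {z | ∃ y ∈ C, |z - y| ≤ b}

end BanachLattice

section Integral

variable {T : Type*} [MetricSpace T] [MeasurableSpace T]

/-- A gauge on `T`: a (not necessarily measurable) map into the positive reals. -/
def IsGauge (γ : T → ℝ) : Prop := ∀ t, 0 < γ t

/-- A (free-tagged) partition of `E ⊆ T`: finitely many pairs of a measurable set and a tag in `T`;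
the sets overlap only in null sets and have union `E`. The tags need not lie in the sets. -/
structure TaggedPartition (μ : Measure T) (E : Set T) where
  /-- the number of pairs -/
  card : ℕ
  /-- the measurable pieces -/
  piece : Fin card → Set T
  /-- the tags -/
  tag : Fin card → T
  measurableSet_piece : ∀ i, MeasurableSet (piece i)
  null_inter : ∀ i j, i ≠ j → μ (piece i ∩ piece j) = 0
  iUnion_piece : ⋃ i, piece i = E

/-- `Q` is `γ`-fine: every point of a piece is closer to its tag than `γ` of the tag. -/
def TaggedPartition.IsFine {μ : Measure T} {E : Set T} (Q : TaggedPartition μ E) (γ : T → ℝ) :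
    Prop :=
  ∀ i, ∀ w ∈ Q.piece i, dist w (Q.tag i) < γ (Q.tag i)

/-- The Riemann sum `∑ μ(Eᵢ) F(tᵢ)` of a multifunction, with Minkowski sums and dilations of sets
(for values in `cwk(X)` this sum is already closed). -/
noncomputable def TaggedPartition.sum {X : Type*} [NormedAddCommGroup X] [NormedSpace ℝ X]
    {μ : Measure T} {E : Set T} (Q : TaggedPartition μ E) (F : T → Set X) : Set X :=
  ∑ i, μ.real (Q.piece i) • F (Q.tag i)

/-- `(oH)`-integrability of the multifunction `F` with respect to `μ`. -/
def OHIntegrable {X : Type*} [NormedAddCommGroup X] [Lattice X] [NormedSpace ℝ X]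
    (F : T → Set X) (μ : Measure T) : Prop :=
  ∀ E : Set T, MeasurableSet E →
    ∃ J : Set X, IsCwk J ∧ ∃ b : ℕ → X, IsOSeq b ∧
      ∃ γ : ℕ → T → ℝ, (∀ n, IsGauge (γ n)) ∧
        ∀ n, ∀ Q : TaggedPartition μ E, Q.IsFine (γ n) →
          Q.sum F ⊆ orderNhd J (b n) ∧ J ⊆ orderNhd (Q.sum F) (b n)

end Integral

end OrderHenstock

namespace OrderHenstock

/-! ### Weakly compact convex sets and their support functions. -/

section WeaklyCompact

variable {X : Type*} [NormedAddCommGroup X] [NormedSpace ℝ X]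

/-! For each functional `f`, `t ↦ sup f(F t)` is monotone, so its Riemann sums over any partition
fine for a constant gauge `d` miss its integral by at most `2d (sup f(F 1) - sup f(F 0))`. The
oscillation is at most `f (y - x)` with `y ∈ F 1` maximising `f` and any `x ∈ F 0`; if `F 1 ⊆ [a,
b]`, then `y - x ∈ [-(b - a), b - a]`. One order interval thus absorbs the errors for all `f`, and
Hahn–Banach turns the scalar estimates into inclusions of sets (`IsCwk.mem_orderNhd`). The integral
`J` is the set of `x` with `f x ≤ ∫_E sup f(F t)` for all `f`. It lies in `λ(E) F(1)`, hence is
weakly compact, and it contains the left-endpoint sums, so its support function is nearly the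
integral. -/

theorem continuous_toWeakSpace_symm_apply (f : StrongDual ℝ X) :
    Continuous fun x : WeakSpace ℝ X => f ((toWeakSpace ℝ X).symm x) :=
  WeakBilin.eval_continuous (topDualPairing ℝ X).flip f

theorem isClosed_of_isClosed_toWeakSpace_image {A : Set X}
    (hA : IsClosed (toWeakSpace ℝ X '' A)) : IsClosed A := by
  have h := hA.preimage (toWeakSpaceCLM ℝ X).continuous
  have e : (toWeakSpaceCLM ℝ X) ⁻¹' (toWeakSpace ℝ X '' A) = A :=
    Set.preimage_image_eq A (toWeakSpace ℝ X).injective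
  rwa [e] at h

/-- Mazur: norm and weak closures of a convex set agree. -/
theorem isClosed_toWeakSpace_image_of_convex {A : Set X} (hc : Convex ℝ A) (hA : IsClosed A) :
    IsClosed (toWeakSpace ℝ X '' A) := by
  have h := hc.toWeakSpace_closure ℝ
  rw [hA.closure_eq] at h
  rw [h]
  exact isClosed_closure

/-- A point outside `C` would be strictly separated from it by some `f`. -/
theorem mem_of_forall_exists_le {C : Set X} (hc : Convex ℝ C) (hC : IsClosed C) {z : X}
    (h : ∀ f : StrongDual ℝ X, ∃ c ∈ C, f z ≤ f c) : z ∈ C := by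
  by_contra hz
  obtain ⟨f, u, h₁, h₂⟩ := geometric_hahn_banach_closed_point hc hC hz
  obtain ⟨c, hcC, hle⟩ := h f
  linarith [h₁ c hcC]

namespace IsCwk

variable {A B : Set X}

theorem isClosed (hA : IsCwk A) : IsClosed A :=
  isClosed_of_isClosed_toWeakSpace_image hA.2.2.isClosed

theorem exists_forall_le (hA : IsCwk A) (f : StrongDual ℝ X) : ∃ y ∈ A, ∀ x ∈ A, f x ≤ f y := by
  obtain ⟨_, ⟨y, hy, rfl⟩, hmax⟩ := hA.2.2.exists_isMaxOn (hA.1.image _)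
    (continuous_toWeakSpace_symm_apply f).continuousOn
  exact ⟨y, hy, fun x hx => by simpa using hmax (mem_image_of_mem _ hx)⟩

theorem smul (hA : IsCwk A) (c : ℝ) : IsCwk (c • A) := by
  refine ⟨hA.1.smul_set, hA.2.1.smul c, ?_⟩
  rw [image_smul_comm _ _ _ fun x => map_smul (toWeakSpace ℝ X) c x]
  exact hA.2.2.smul c

theorem add (hA : IsCwk A) (hB : IsCwk B) : IsCwk (A + B) := by
  refine ⟨hA.1.add hB.1, hA.2.1.add hB.2.1, ?_⟩
  rw [image_add]
  exact hA.2.2.add hB.2.2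

theorem singleton (x : X) : IsCwk ({x} : Set X) :=
  ⟨singleton_nonempty x, convex_singleton x, by rw [image_singleton]; exact isCompact_singleton⟩

theorem finsetSum {ι : Type*} (s : Finset ι) {A : ι → Set X} (hA : ∀ i, IsCwk (A i)) :
    IsCwk (∑ i ∈ s, A i) := by
  classical
  induction s using Finset.induction_on with
  | empty => simpa [← Set.singleton_zero] using singleton (0 : X)
  | insert i s hi ih => rw [Finset.sum_insert hi]; exact (hA i).add ih

theorem of_isClosed_subset (hA : IsCwk A) (hne : B.Nonempty) (hc : Convex ℝ B) (hB : IsClosed B)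
    (hBA : B ⊆ A) : IsCwk B :=
  ⟨hne, hc, hA.2.2.of_isClosed_subset (isClosed_toWeakSpace_image_of_convex hc hB)
    (image_mono hBA)⟩

theorem isClosed_add (hA : IsCwk A) (hc : Convex ℝ B) (hB : IsClosed B) : IsClosed (A + B) := by
  apply isClosed_of_isClosed_toWeakSpace_image
  rw [image_add]
  exact (isClosed_toWeakSpace_image_of_convex hc hB).add_left_of_isCompact hA.2.2

end IsCwk

/-- The support function `f ↦ sup f(A)` of a set. -/
noncomputable def supportFun (A : Set X) (f : StrongDual ℝ X) : ℝ := sSup (f '' A)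

theorem IsCwk.le_supportFun {A : Set X} (hA : IsCwk A) (f : StrongDual ℝ X) {x : X} (hx : x ∈ A) :
    f x ≤ supportFun A f := by
  obtain ⟨y, -, hmax⟩ := hA.exists_forall_le f
  exact le_csSup ⟨f y, by rintro _ ⟨z, hz, rfl⟩; exact hmax z hz⟩ (mem_image_of_mem f hx)

theorem IsCwk.exists_eq_supportFun {A : Set X} (hA : IsCwk A) (f : StrongDual ℝ X) :
    ∃ y ∈ A, f y = supportFun A f := by
  obtain ⟨y, hy, hmax⟩ := hA.exists_forall_le f
  refine ⟨y, hy, le_antisymm (hA.le_supportFun f hy) ?_⟩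
  exact csSup_le ⟨f y, mem_image_of_mem f hy⟩ (by rintro _ ⟨z, hz, rfl⟩; exact hmax z hz)

theorem IsCwk.supportFun_mono {A B : Set X} (hA : IsCwk A) (hB : IsCwk B) (h : A ⊆ B)
    (f : StrongDual ℝ X) : supportFun A f ≤ supportFun B f := by
  obtain ⟨y, hy, e⟩ := hA.exists_eq_supportFun f
  exact e ▸ hB.le_supportFun f (h hy)

section RiemannSum

variable {T : Type*} [MeasurableSpace T] {μ : Measure T} {E : Set T}
  {F : T → Set X}

theorem TaggedPartition.isCwk_sum (Q : TaggedPartition μ E) (hF : ∀ t, IsCwk (F t)) :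
    IsCwk (Q.sum F) :=
  IsCwk.finsetSum _ fun i => (hF (Q.tag i)).smul _

theorem TaggedPartition.le_sum_supportFun (Q : TaggedPartition μ E) (hF : ∀ t, IsCwk (F t))
    (f : StrongDual ℝ X) {x : X} (hx : x ∈ Q.sum F) :
    f x ≤ ∑ i, μ.real (Q.piece i) * supportFun (F (Q.tag i)) f := by
  obtain ⟨g, hg, rfl⟩ := (Set.mem_fintype_sum _ _).1 hx
  rw [map_sum]
  refine Finset.sum_le_sum fun i _ => ?_
  obtain ⟨y, hy, e⟩ := Set.mem_smul_set.1 (hg i)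
  rw [← e, map_smul, smul_eq_mul]
  exact mul_le_mul_of_nonneg_left ((hF _).le_supportFun f hy) measureReal_nonneg

theorem TaggedPartition.exists_eq_sum_supportFun (Q : TaggedPartition μ E)
    (hF : ∀ t, IsCwk (F t)) (f : StrongDual ℝ X) :
    ∃ x ∈ Q.sum F, f x = ∑ i, μ.real (Q.piece i) * supportFun (F (Q.tag i)) f := by
  choose y hy e using fun t => (hF t).exists_eq_supportFun f
  refine ⟨∑ i, μ.real (Q.piece i) • y (Q.tag i),
    (Set.mem_fintype_sum _ _).2 ⟨_, fun i => smul_mem_smul_set (hy _), rfl⟩, ?_⟩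
  simp [map_sum, e]

end RiemannSum

end WeaklyCompact

/-! ### Riemann sums of monotone functions on the unit interval. -/

section MonotoneIntegral

variable {E : Set (Icc (0 : ℝ) 1)}

instance isFiniteMeasure_volume_Icc_zero_one :
    IsFiniteMeasure (volume : Measure (Icc (0 : ℝ) 1)) :=
  inferInstanceAs (IsFiniteMeasure (volume : Measure unitInterval))

theorem integrable_of_monotone_Icc {g : Icc (0 : ℝ) 1 → ℝ} (hg : Monotone g) : Integrable g := by
  refine Integrable.of_bound hg.measurable.aestronglyMeasurable (|g 0| + |g 1|)
    (ae_of_all _ fun t => ?_)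
  have h₀ : g 0 ≤ g t := hg t.2.1
  have h₁ : g t ≤ g 1 := hg t.2.2
  rw [Real.norm_eq_abs, abs_le]
  constructor <;> linarith [neg_abs_le (g 0), le_abs_self (g 1), abs_nonneg (g 0), abs_nonneg (g 1)]

theorem TaggedPartition.setIntegral_eq_sum {T : Type*} [MeasurableSpace T]
    {μ : Measure T} {E : Set T} (Q : TaggedPartition μ E) {g : T → ℝ} (hg : Integrable g μ) :
    ∫ t in E, g t ∂μ = ∑ i, ∫ t in Q.piece i, g t ∂μ := by
  have h := integral_iUnion_ae (μ := μ) (fun i => (Q.measurableSet_piece i).nullMeasurableSet)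
    (fun i j hij => Q.null_inter i j hij) hg.integrableOn
  rwa [Q.iUnion_piece, tsum_fintype] at h

/-- The translated integrals cancel except on windows of length `2d` around `0` and `1`. -/
theorem integral_translate_sub_le {h : ℝ → ℝ} (hh : Monotone h) {m M : ℝ} (hm : ∀ x, m ≤ h x)
    (hM : ∀ x, h x ≤ M) {d : ℝ} (hd : 0 ≤ d) :
    ∫ x in (0 : ℝ)..1, (h (x + d) - h (x - d)) ≤ 2 * d * (M - m) := by
  have hi : ∀ a b, IntervalIntegrable h volume a b := fun a b => hh.intervalIntegrable
  have hp : IntervalIntegrable (fun x => h (x + d)) volume 0 1 :=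
    Monotone.intervalIntegrable fun x y hxy => hh (by linarith)
  have hq : IntervalIntegrable (fun x => h (x - d)) volume 0 1 :=
    Monotone.intervalIntegrable fun x y hxy => hh (by linarith)
  rw [intervalIntegral.integral_sub hp hq, intervalIntegral.integral_comp_add_right,
    intervalIntegral.integral_comp_sub_right,
    intervalIntegral.integral_interval_sub_interval_comm (hi _ _) (hi _ _) (hi _ _)]
  have h₁ : ∫ x in (0 - d)..(0 + d), h x ≥ 2 * d * m := by
    have := intervalIntegral.integral_mono_on (μ := volume) (show 0 - d ≤ 0 + d by linarith)
      (intervalIntegrable_const (c := m)) (hi _ _) fun x _ => hm x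
    rw [intervalIntegral.integral_const, smul_eq_mul] at this
    linarith
  have h₂ : ∫ x in (1 - d)..(1 + d), h x ≤ 2 * d * M := by
    have := intervalIntegral.integral_mono_on (μ := volume) (show 1 - d ≤ 1 + d by linarith)
      (hi _ _) (intervalIntegrable_const (c := M)) fun x _ => hM x
    rw [intervalIntegral.integral_const, smul_eq_mul] at this
    linarith
  rw [intervalIntegral.integral_symm (0 - d) (0 + d),
    intervalIntegral.integral_symm (1 - d) (1 + d)]
  linarith

/-- Riemann sums of a monotone function over partitions which are fine for a constant gauge `d`
approximate its integral, with an error which does not depend on the partition. -/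
theorem TaggedPartition.abs_sum_sub_setIntegral_le {g : Icc (0 : ℝ) 1 → ℝ} (hg : Monotone g)
    {d : ℝ} (hd : 0 ≤ d) (Q : TaggedPartition (volume : Measure (Icc (0 : ℝ) 1)) E)
    (hQ : Q.IsFine fun _ => d) :
    |∑ i, volume.real (Q.piece i) * g (Q.tag i) - ∫ t in E, g t| ≤ 2 * d * (g 1 - g 0) := by
  -- Constant extension beyond the end points lets `w ± d` leave the interval.
  set h : ℝ → ℝ := IccExtend (zero_le_one' ℝ) g with hdef
  have hh : Monotone h := hg.IccExtend _
  have hext : ∀ t : Icc (0 : ℝ) 1, h t = g t := fun t => IccExtend_val _ _ t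
  set φ : ℝ → ℝ := fun x => h (x + d) - h (x - d) with hφ
  have hφ0 : ∀ x, 0 ≤ φ x := fun x => sub_nonneg.2 (hh (by linarith))
  have hgi := integrable_of_monotone_Icc hg
  have hφi : Integrable (fun t : Icc (0 : ℝ) 1 => φ t) :=
    (integrable_of_monotone_Icc fun s t (hst : (s : ℝ) ≤ t) => hh (by linarith)).sub
      (integrable_of_monotone_Icc fun s t (hst : (s : ℝ) ≤ t) => hh (by linarith))
  have key : ∀ i, |volume.real (Q.piece i) * g (Q.tag i) - ∫ t in Q.piece i, g t|
      ≤ ∫ t in Q.piece i, φ t := by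
    intro i
    have e : volume.real (Q.piece i) * g (Q.tag i) - ∫ t in Q.piece i, g t
        = ∫ t in Q.piece i, (g (Q.tag i) - g t) := by
      rw [integral_sub (integrable_const _) hgi.integrableOn, setIntegral_const, smul_eq_mul]
    rw [e]
    refine (abs_integral_le_integral_abs).trans (setIntegral_mono_on
      ((integrable_const _).sub hgi.integrableOn).abs hφi.integrableOn
      (Q.measurableSet_piece i) fun w hw => ?_)
    have hw' := hQ i w hw
    rw [Subtype.dist_eq, Real.dist_eq, abs_lt] at hw'
    -- Both `g w` and `g` of the tag lie between `h (w - d)` and `h (w + d)`.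
    have h₁ : h (w - d) ≤ g (Q.tag i) := hext (Q.tag i) ▸ hh (by linarith)
    have h₂ : g (Q.tag i) ≤ h (w + d) := hext (Q.tag i) ▸ hh (by linarith)
    have h₃ : h (w - d) ≤ g w := hext w ▸ hh (by linarith)
    have h₄ : g w ≤ h (w + d) := hext w ▸ hh (by linarith)
    rw [abs_le]
    constructor <;> simp only [hφ] <;> linarith
  rw [Q.setIntegral_eq_sum hgi, ← Finset.sum_sub_distrib]
  calc _ ≤ ∑ i, ∫ t in Q.piece i, φ t :=
        (Finset.abs_sum_le_sum_abs _ _).trans (Finset.sum_le_sum fun i _ => key i)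
    _ = ∫ t in E, φ t := (Q.setIntegral_eq_sum hφi).symm
    _ ≤ ∫ t : Icc (0 : ℝ) 1, φ t := setIntegral_le_integral hφi (ae_of_all _ fun t => hφ0 t)
    _ = ∫ x in (0 : ℝ)..1, φ x := by
        rw [integral_subtype measurableSet_Icc φ, integral_Icc_eq_integral_Ioc,
          intervalIntegral.integral_of_le zero_le_one]
    _ ≤ _ := integral_translate_sub_le hh (fun x => hg (projIcc 0 1 zero_le_one x).2.1)
        (fun x => hg (projIcc 0 1 zero_le_one x).2.2) hd

/-- The partition of `E` into its parts in `[k/N, (k+1)/N)`, tagged by the left end points. -/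
noncomputable def leftPartition (N : ℕ) (hE : MeasurableSet E) :
    TaggedPartition (volume : Measure (Icc (0 : ℝ) 1)) E where
  -- The extra index `N` accounts for the point `t = 1`.
  card := N + 1
  piece k := E ∩ {t | ⌊(t : ℝ) * N⌋₊ = k}
  tag k := projIcc 0 1 zero_le_one ((k : ℝ) / N)
  measurableSet_piece k := hE.inter <|
    (Nat.measurable_floor.comp (measurable_subtype_coe.mul_const _)) (measurableSet_singleton _)
  null_inter i j hij := by
    have : (E ∩ {t : Icc (0 : ℝ) 1 | ⌊(t : ℝ) * N⌋₊ = i}) ∩ (E ∩ {t | ⌊(t : ℝ) * N⌋₊ = j}) = ∅ := by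
      ext t
      simp only [mem_inter_iff, mem_ofPred_eq, mem_empty_iff_false, iff_false]
      rintro ⟨⟨-, h₁⟩, -, h₂⟩
      exact hij (Fin.ext (h₁.symm.trans h₂))
    rw [this, measure_empty]
  iUnion_piece := by
    ext t
    simp only [mem_iUnion, mem_inter_iff, mem_ofPred_eq, exists_and_left, and_iff_left_iff_imp]
    intro _
    have : ⌊(t : ℝ) * N⌋₊ ≤ N :=
      Nat.floor_le_of_le (mul_le_of_le_one_left (Nat.cast_nonneg N) t.2.2)
    exact ⟨⟨_, Nat.lt_succ_of_le this⟩, rfl⟩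

theorem leftPartition_tag_mem {N : ℕ} (hN : 0 < N) (hE : MeasurableSet E)
    (k : Fin (leftPartition N hE).card) {w : Icc (0 : ℝ) 1}
    (hw : w ∈ (leftPartition N hE).piece k) :
    (leftPartition N hE).tag k ≤ w ∧ (w : ℝ) < (leftPartition N hE).tag k + 1 / N := by
  have hN' : (0 : ℝ) < N := Nat.cast_pos.2 hN
  have hk : ⌊(w : ℝ) * N⌋₊ = (k : ℕ) := hw.2
  have hw0 : 0 ≤ (w : ℝ) * N := mul_nonneg w.2.1 hN'.le
  have h₁ : ((k : ℕ) : ℝ) / N ≤ w := by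
    rw [div_le_iff₀ hN', ← hk]; exact Nat.floor_le hw0
  have h₂ : (w : ℝ) < (k : ℕ) / N + 1 / N := by
    rw [← add_div, lt_div_iff₀ hN', ← hk]; exact Nat.lt_floor_add_one _
  have htag : (((leftPartition N hE).tag k : Icc (0 : ℝ) 1) : ℝ) = (k : ℕ) / N :=
    congrArg Subtype.val (projIcc_of_mem zero_le_one (x := ((k : ℕ) : ℝ) / N)
      ⟨by positivity, h₁.trans w.2.2⟩)
  rw [← Subtype.coe_le_coe, htag]
  exact ⟨h₁, h₂⟩

theorem leftPartition_isFine {N : ℕ} (hN : 0 < N) (hE : MeasurableSet E) :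
    (leftPartition N hE).IsFine fun _ => 1 / N := by
  intro k w hw
  obtain ⟨h₁, h₂⟩ := leftPartition_tag_mem hN hE k hw
  rw [← Subtype.coe_le_coe] at h₁
  rw [Subtype.dist_eq, Real.dist_eq, abs_of_nonneg (sub_nonneg.2 h₁)]
  linarith

theorem leftPartition_sum_le {N : ℕ} (hN : 0 < N) (hE : MeasurableSet E) {g : Icc (0 : ℝ) 1 → ℝ}
    (hg : Monotone g) :
    ∑ i, volume.real ((leftPartition N hE).piece i) * g ((leftPartition N hE).tag i)
      ≤ ∫ t in E, g t := by
  have hgi := integrable_of_monotone_Icc hg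
  rw [(leftPartition N hE).setIntegral_eq_sum hgi]
  refine Finset.sum_le_sum fun i _ => ?_
  rw [← smul_eq_mul, ← setIntegral_const]
  exact setIntegral_mono_on (integrable_const _) hgi.integrableOn
    ((leftPartition N hE).measurableSet_piece i) fun w hw =>
      hg (leftPartition_tag_mem hN hE i hw).1

end MonotoneIntegral

/-! ### The integral as a set, and order neighbourhoods. -/

section BanachLattice

theorem add_Icc_subset_orderNhd {X : Type*} [NormedAddCommGroup X] [Lattice X]
    [IsOrderedAddMonoid X] (C : Set X) (b : X) : C + Icc (-b) b ⊆ orderNhd C b := by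
  rintro _ ⟨y, hy, z, hz, rfl⟩
  refine ⟨y, hy, ?_⟩
  change |y + z - y| ≤ b
  rw [add_sub_cancel_left]
  exact abs_le'.2 ⟨hz.2, neg_le.1 hz.1⟩

variable {X : Type*} [NormedAddCommGroup X] [NormedSpace ℝ X]

/-- The closed convex set whose support function is dominated by the integral over `E` of the
support functions of the values of `F`. -/
def supportIntegral {T : Type*} [MeasurableSpace T] (F : T → Set X) (μ : Measure T) (E : Set T) :
    Set X :=
  {x | ∀ f : StrongDual ℝ X, f x ≤ ∫ t in E, supportFun (F t) f ∂μ}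

theorem isClosed_supportIntegral {T : Type*} [MeasurableSpace T] (F : T → Set X) (μ : Measure T)
    (E : Set T) : IsClosed (supportIntegral F μ E) := by
  simp only [supportIntegral, ofPred_forall]
  exact isClosed_iInter fun f => isClosed_le f.continuous continuous_const

theorem convex_supportIntegral {T : Type*} [MeasurableSpace T] (F : T → Set X) (μ : Measure T)
    (E : Set T) : Convex ℝ (supportIntegral F μ E) := by
  simp only [supportIntegral, ofPred_forall]
  exact convex_iInter fun f => convex_halfSpace_le f.isLinear _

section Monotone

variable {F : Icc (0 : ℝ) 1 → Set X} (hF : ∀ t, IsCwk (F t)) (hmono : ∀ s t, s ≤ t → F s ⊆ F t)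
  {E : Set (Icc (0 : ℝ) 1)} (hE : MeasurableSet E)

include hF hmono

theorem monotone_supportFun (f : StrongDual ℝ X) : Monotone fun t => supportFun (F t) f :=
  fun s t hst => (hF s).supportFun_mono (hF t) (hmono s t hst) f

theorem leftPartition_sum_subset_supportIntegral {N : ℕ} (hN : 0 < N) :
    (leftPartition N hE).sum F ⊆ supportIntegral F volume E := fun _ hx f =>
  ((leftPartition N hE).le_sum_supportFun hF f hx).trans
    (leftPartition_sum_le hN hE (monotone_supportFun hF hmono f))

theorem supportIntegral_subset_smul : supportIntegral F volume E ⊆ volume.real E • F 1 := by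
  intro x hx
  have hc := (hF 1).smul (volume.real E)
  refine mem_of_forall_exists_le hc.2.1 hc.isClosed fun f => ?_
  obtain ⟨y, hy, e⟩ := (hF 1).exists_eq_supportFun f
  refine ⟨_, smul_mem_smul_set hy, (hx f).trans ?_⟩
  rw [map_smul, e, ← setIntegral_const]
  have hg := monotone_supportFun hF hmono f
  exact integral_mono (integrable_of_monotone_Icc hg).integrableOn (integrable_const _)
    fun t => hg t.2.2

theorem isCwk_supportIntegral (hE : MeasurableSet E) : IsCwk (supportIntegral F volume E) :=
  ((hF 1).smul (volume.real E)).of_isClosed_subset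
    (((leftPartition 1 hE).isCwk_sum hF).1.mono
      (leftPartition_sum_subset_supportIntegral hF hmono hE one_pos))
    (convex_supportIntegral F volume E) (isClosed_supportIntegral F volume E)
    (supportIntegral_subset_smul hF hmono)

end Monotone

variable [Lattice X] [IsOrderedAddMonoid X] [IsOrderedModule ℝ X] [HasSolidNorm X]

/-- A point lies in an order neighbourhood of a weakly compact convex set `C` once every functional
exceeds its support function there by at most a multiple of its variation on an order interval. -/
theorem IsCwk.mem_orderNhd {C : Set X} (hC : IsCwk C) {A B : Set X} (hA : IsCwk A) (hB : IsCwk B)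
    {a b : X} (hAab : A ⊆ Icc a b) (hBab : B ⊆ Icc a b) {r : ℝ} (hr : 0 ≤ r) {z : X}
    (hz : ∀ f : StrongDual ℝ X, ∃ c ∈ C, f z ≤ f c + r * (supportFun B f - supportFun A f)) :
    z ∈ orderNhd C (r • (b - a)) := by
  refine add_Icc_subset_orderNhd C _ (mem_of_forall_exists_le
    (hC.2.1.add (convex_Icc _ _)) (hC.isClosed_add (convex_Icc _ _) isClosed_Icc) fun f => ?_)
  obtain ⟨c, hc, hle⟩ := hz f
  obtain ⟨x, hx⟩ := hA.1
  obtain ⟨y, hy, e⟩ := hB.exists_eq_supportFun f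
  have hx' := hAab hx
  have hy' := hBab hy
  -- Here `f (y - x)` dominates the oscillation, since `y` attains the supremum over `B` and `x ∈
  -- A`.
  refine ⟨c + r • (y - x), add_mem_add hc ⟨?_, ?_⟩, ?_⟩
  · rw [← smul_neg, neg_sub]
    exact smul_le_smul_of_nonneg_left (sub_le_sub hy'.1 hx'.2) hr
  · exact smul_le_smul_of_nonneg_left (sub_le_sub hy'.2 hx'.1) hr
  · rw [map_add, map_smul, map_sub, e, smul_eq_mul]
    have := mul_le_mul_of_nonneg_left (hA.le_supportFun f hx) hr
    linarith

theorem isOSeq_smul {c : ℕ → ℝ} (hc : Antitone c)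
    (hc0 : Filter.Tendsto c Filter.atTop (nhds 0)) {v : X} (hv : 0 ≤ v) :
    IsOSeq fun n => c n • v := by
  have ha : Antitone fun n => c n • v := fun m n hmn => smul_le_smul_of_nonneg_right (hc hmn) hv
  exact ⟨ha, isGLB_of_tendsto_atTop ha (by simpa using hc0.smul_const v)⟩

end BanachLattice

end OrderHenstock

/-- The gauges are constant and the error is a multiple of `1 / (n + 1)` of one fixed positive
element, so that order-continuity of the norm is not needed. -/
theorem theorem4p1 {X : Type*} [NormedAddCommGroup X] [NormedSpace ℝ X] [CompleteSpace X]
    [Lattice X] [IsOrderedAddMonoid X] [IsOrderedModule ℝ X] [HasSolidNorm X]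
    (hX : OrderHenstock.OrderContinuousNorm X)
    (F : Set.Icc (0 : ℝ) 1 → Set X)
    (hF : ∀ t, OrderHenstock.IsCwk (F t))
    (hFb : ∀ t, OrderHenstock.IsOrderBounded (F t))
    (hmono : ∀ s t, s ≤ t → F s ⊆ F t) :
    OrderHenstock.OHIntegrable F (MeasureTheory.volume : MeasureTheory.Measure (Set.Icc (0 : ℝ) 1)) := by
  intro E hE
  obtain ⟨a, b, hab⟩ := hFb 1
  have h01 : F 0 ⊆ F 1 := hmono 0 1 zero_le_one
  obtain ⟨x, hx⟩ := (hF 0).1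
  have hv : 0 ≤ b - a := sub_nonneg.2 ((hab (h01 hx)).1.trans (hab (h01 hx)).2)
  -- The factor `4` is `2` for the given partition plus `2` for the left-endpoint one.
  have hlim : Filter.Tendsto (fun n : ℕ => 4 * (1 / ((n : ℝ) + 1))) Filter.atTop (nhds 0) := by
    simpa using (tendsto_one_div_add_atTop_nhds_zero_nat (𝕜 := ℝ)).const_mul 4
  have hanti : Antitone fun n : ℕ => 4 * (1 / ((n : ℝ) + 1)) := fun m n hmn =>
    mul_le_mul_of_nonneg_left (Nat.one_div_le_one_div hmn) (by norm_num)
  refine ⟨OrderHenstock.supportIntegral F MeasureTheory.volume E,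
    OrderHenstock.isCwk_supportIntegral hF hmono hE, _, OrderHenstock.isOSeq_smul hanti hlim hv,
    fun n _ => 1 / ((n : ℝ) + 1), fun n _ => by positivity, fun n Q hQ => ?_⟩
  have hd : (0 : ℝ) ≤ 1 / ((n : ℝ) + 1) := by positivity
  have hr : (0 : ℝ) ≤ 4 * (1 / ((n : ℝ) + 1)) := by positivity
  have hJ := OrderHenstock.isCwk_supportIntegral hF hmono hE
  have hg := OrderHenstock.monotone_supportFun hF hmono
  -- With `n + 1` cells the mesh matches the gauge.
  have hL := OrderHenstock.leftPartition_isFine (Nat.succ_pos n) hE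
  rw [Nat.cast_succ] at hL
  have hosc : ∀ f, 0 ≤ 1 / ((n : ℝ) + 1) *
      (OrderHenstock.supportFun (F 1) f - OrderHenstock.supportFun (F 0) f) := fun f =>
    mul_nonneg hd (sub_nonneg.2 (hg f zero_le_one))
  refine ⟨fun z hz => ?_, fun z hz => ?_⟩
  · refine hJ.mem_orderNhd (hF 0) (hF 1) (h01.trans hab) hab hr fun f => ?_
    obtain ⟨y, hy, e⟩ :=
      (OrderHenstock.leftPartition (n + 1) hE).exists_eq_sum_supportFun hF f
    refine ⟨y, OrderHenstock.leftPartition_sum_subset_supportIntegral hF hmono hE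
      (Nat.succ_pos n) hy, ?_⟩
    have h₁ := Q.le_sum_supportFun hF f hz
    have h₂ := abs_le.1 (Q.abs_sum_sub_setIntegral_le (hg f) hd hQ)
    have h₃ := abs_le.1 (OrderHenstock.TaggedPartition.abs_sum_sub_setIntegral_le (hg f) hd _ hL)
    rw [← e] at h₃
    linarith [h₂.2, h₃.1]
  · refine (Q.isCwk_sum hF).mem_orderNhd (hF 0) (hF 1) (h01.trans hab) hab hr fun f => ?_
    obtain ⟨y, hy, e⟩ := Q.exists_eq_sum_supportFun hF f
    refine ⟨y, hy, ?_⟩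
    have h₂ := abs_le.1 (Q.abs_sum_sub_setIntegral_le (hg f) hd hQ)
    rw [← e] at h₂
    -- Only half of the allowed error is needed; `hosc` discards the rest.
    linarith [h₂.1, hz f, hosc f]
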